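/- Let $X$ be a real Hilbert space, let $m\ge 2$, and let $T_1,\dots,T_m\colon X\to X$ be firmly nonexpansive, i.e. $\|T_ix-T_iy\|^2\le\langle x-y,\,T_ix-T_iy\rangle$ for all $x,y\in X$. For a nonexpansive map $T\colon X\to X$ let $v_T:=P_{\overline{\operatorname{ran}}(\mathrm{Id}-T)}(0)$ be its minimal displacement vector, the unique element of least norm of the nonempty closed convex set $\overline{\{x-Tx : x\in X\}}$. Then: 1. For every $\varepsilon>0$ there exists $x\in X$ such that $\|x-T_mT_{m-1}\cdots T_1x\|\le\varepsilon+\sum_{k=1}^m\|v_{T_k}\|$. 2. $\|v_{T_m\cdots T_1}\|\le\|v_{T_1}\|+\cdots+\|v_{T_m}\|$. 3. The bound in 2 is sharp: for every $m\ge2$ and all real numbers $c_1,\dots,c_m\ge0$ there are firmly nonexpansive maps $T_1,\dots,T_m\colon\mathbb R\to\mathbb R$ with $|v_{T_i}|=c_i$ for every $i$ and $|v_{T_m\cdots T_1}|=|v_{T_1}|+\cdots+|v_{T_m}|$. Moreover, for all $a_1,a_2\in\mathbb R$, the maps $T_i\colon\mathbb R\to\mathbb R$, $x\mapsto x-a_i$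 $(i=1,2)$ are firmly nonexpansive and satisfy $v_{T_1}=a_1$, $v_{T_2}=a_2$, $v_{T_2T_1}=a_1+a_2$, and $|v_{T_2T_1}|=|v_{T_1}|+|v_{T_2}|$ holds if and only if $a_1a_2\ge0$. -/

import Mathlib

open scoped InnerProductSpace

/-- `T` is firmly nonexpansive: `‖Tx - Ty‖² ≤ ⟪x - y, Tx - Ty⟫` for all `x`, `y`. -/
def FirmlyNonexpansive {X : Type*} [NormedAddCommGroup X] [InnerProductSpace ℝ X]
    (T : X → X) : Prop :=
  ∀ x y : X, ‖T x - T y‖ ^ 2 ≤ ⟪x - y, T x - T y⟫_ℝ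

/-- `p` is a nearest point to `x` in the set `C`. -/
def IsNearestPoint {X : Type*} [NormedAddCommGroup X] (C : Set X) (x p : X) : Prop :=
  p ∈ C ∧ ∀ y ∈ C, ‖x - p‖ ≤ ‖x - y‖

open Classical in
/-- The projection `P_C x` of `x` onto `C`: the point of `C` nearest to `x`. For a nonempty closed
convex subset of a Hilbert space it exists and is unique, see `existsUnique_isNearestPoint`; the
default value `0` is used only for sets without a nearest point to `x`. -/
noncomputable def metricProj {X : Type*} [NormedAddCommGroup X] (C : Set X) (x : X) : X :=
  if h : ∃ p, IsNearestPoint C x p then h.choose else 0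

/-- The closure of the range of `Id - T`. -/
def displacementClosure {X : Type*} [NormedAddCommGroup X] (T : X → X) : Set X :=
  closure (Set.range fun x => x - T x)

/-- The minimal displacement vector `v_T`, the projection of `0` onto the closure of
`ran (Id - T)`. It is well defined for nonexpansive `T`, see `minDisplacement_spec`. -/
noncomputable def minDisplacement {X : Type*} [NormedAddCommGroup X] (T : X → X) : X :=
  metricProj (displacementClosure T) 0

/-- The composition `T_m ∘ ⋯ ∘ T_1` of a family indexed by `Fin m` (index `0` acts first). -/
def composition {X : Type*} : {m : ℕ} → (Fin m → X → X) → X → X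
  | 0, _ => id
  | m + 1, T => T (Fin.last m) ∘ composition fun i : Fin m => T i.castSucc

theorem existsUnique_isNearestPoint {X : Type*} [NormedAddCommGroup X] [InnerProductSpace ℝ X]
    [CompleteSpace X] {C : Set X} (hne : C.Nonempty) (hcl : IsClosed C) (hcv : Convex ℝ C)
    (x : X) : ∃! p, IsNearestPoint C x p := by
  have key : ∀ p, IsNearestPoint C x p → ∀ w ∈ C, ⟪x - p, w - p⟫_ℝ ≤ 0 := by
    rintro p ⟨hp, hmin⟩
    refine (norm_eq_iInf_iff_real_inner_le_zero hcv hp).1 (le_antisymm ?_ ?_)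
    · have : Nonempty C := hne.to_subtype
      exact le_ciInf fun y => hmin y y.2
    · exact ciInf_le ⟨0, by rintro _ ⟨y, rfl⟩; exact norm_nonneg _⟩ (⟨p, hp⟩ : C)
  obtain ⟨p, hp, hpe⟩ := exists_norm_eq_iInf_of_complete_convex hne hcl.isComplete hcv x
  refine ⟨p, ⟨hp, fun y hy => hpe ▸
    ciInf_le ⟨0, by rintro _ ⟨y, rfl⟩; exact norm_nonneg _⟩ (⟨y, hy⟩ : C)⟩, fun q hq => ?_⟩
  have hp' : IsNearestPoint C x p := ⟨hp, fun y hy => hpe ▸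
    ciInf_le ⟨0, by rintro _ ⟨y, rfl⟩; exact norm_nonneg _⟩ (⟨y, hy⟩ : C)⟩
  have h1 := key p hp' q hq.1
  have h2 := key q hq p hp
  have h3 : ⟪q - p, q - p⟫_ℝ = ⟪x - p, q - p⟫_ℝ + ⟪x - q, p - q⟫_ℝ := by
    rw [← neg_sub q p, inner_neg_right, ← sub_eq_add_neg, ← inner_sub_left]
    congr 1
    abel
  have h4 : ⟪q - p, q - p⟫_ℝ = 0 := le_antisymm (by linarith) real_inner_self_nonneg
  exact sub_eq_zero.1 (inner_self_eq_zero.1 h4)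

theorem convex_displacementClosure {X : Type*} [NormedAddCommGroup X] [InnerProductSpace ℝ X]
    [CompleteSpace X] {T : X → X} (hT : LipschitzWith 1 T) :
    Convex ℝ (displacementClosure T) := by
  have hmono : ∀ x z : X, 0 ≤ ⟪(x - T x) - (z - T z), x - z⟫_ℝ := by
    intro x z
    have h1 : ‖T x - T z‖ ≤ ‖x - z‖ := by simpa using hT.norm_sub_le x z
    have h2 : ⟪T x - T z, x - z⟫_ℝ ≤ ‖x - z‖ * ‖x - z‖ :=
      (real_inner_le_norm _ _).trans (by gcongr)
    have h3 : (x - T x) - (z - T z) = (x - z) - (T x - T z) := by abel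
    rw [h3, inner_sub_left, real_inner_self_eq_norm_mul_norm]
    linarith
  have hres : ∀ (w : X) (e : ℝ), 0 < e → ∃ x, e • x + (x - T x) = w := by
    intro w e he
    have hk : (1 + e)⁻¹ < 1 := inv_lt_one_of_one_lt₀ (by linarith)
    have hk0 : 0 ≤ (1 + e)⁻¹ := by positivity
    have hc : ContractingWith (⟨(1 + e)⁻¹, hk0⟩ : NNReal) fun x => (1 + e)⁻¹ • (T x + w) := by
      refine ⟨by exact_mod_cast hk, LipschitzWith.of_dist_le_mul fun x y => ?_⟩
      have h1 : ‖T x - T y‖ ≤ ‖x - y‖ := by simpa using hT.norm_sub_le x y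
      rw [dist_eq_norm, dist_eq_norm, ← smul_sub, add_sub_add_right_eq_sub, norm_smul,
        Real.norm_of_nonneg hk0]
      exact mul_le_mul_of_nonneg_left h1 hk0
    have hx := hc.fixedPoint_isFixedPt
    set x := ContractingWith.fixedPoint _ hc
    have hx' : (1 + e)⁻¹ • (T x + w) = x := hx
    refine ⟨x, ?_⟩
    have h2 : T x + w = (1 + e) • x := by
      rw [← hx', smul_smul, mul_inv_cancel₀ (by positivity), one_smul, hx']
    have h3 : w = (1 + e) • x - T x := by rw [← h2]; abel
    rw [h3, add_smul, one_smul]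
    abel
  have hrange : ∀ z₀ z₁ : X, ∀ a b : ℝ, 0 ≤ a → 0 ≤ b → a + b = 1 →
      a • (z₀ - T z₀) + b • (z₁ - T z₁) ∈ displacementClosure T := by
    intro z₀ z₁ a b ha hb hab
    set y₀ := z₀ - T z₀ with hy₀
    set y₁ := z₁ - T z₁ with hy₁
    set w := a • y₀ + b • y₁ with hw
    set N := ‖a • z₀ + b • z₁‖
    set K := |a * ⟪w - y₀, z₀⟫_ℝ + b * ⟪w - y₁, z₁⟫_ℝ|
    have hN : 0 ≤ N := norm_nonneg _
    have hK : 0 ≤ K := abs_nonneg _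
    refine Metric.mem_closure_iff.2 fun d hd => ?_
    obtain ⟨e, he, hed⟩ : ∃ e : ℝ, 0 < e ∧ e * (N * d + K) < d ^ 2 := by
      refine ⟨d ^ 2 / (N * d + K + 1), by positivity, ?_⟩
      rw [div_mul_eq_mul_div, div_lt_iff₀ (by positivity)]
      nlinarith [pow_pos hd 2]
    obtain ⟨x, hx⟩ := hres w e he
    have hF : x - T x = w - e • x := by rw [← hx]; abel
    refine ⟨_, ⟨x, rfl⟩, ?_⟩
    have hd' : dist w (x - T x) = e * ‖x‖ := by
      rw [hF, dist_eq_norm, sub_sub_cancel, norm_smul, Real.norm_of_nonneg he.le]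
    simp only [hd']
    have m0 := hmono x z₀
    have m1 := hmono x z₁
    rw [hF] at m0 m1
    rw [← hy₀] at m0
    rw [← hy₁] at m1
    have hsum : 0 ≤ a * ⟪w - e • x - y₀, x - z₀⟫_ℝ + b * ⟪w - e • x - y₁, x - z₁⟫_ℝ := by
      positivity
    have hb' : b = 1 - a := by linarith
    have hex : a * ⟪w - e • x - y₀, x - z₀⟫_ℝ + b * ⟪w - e • x - y₁, x - z₁⟫_ℝ =
        - (e * ‖x‖ ^ 2) + e * ⟪x, a • z₀ + b • z₁⟫_ℝ
          - (a * ⟪w - y₀, z₀⟫_ℝ + b * ⟪w - y₁, z₁⟫_ℝ) := by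
      have hwx : ⟪w, x⟫_ℝ = a * ⟪y₀, x⟫_ℝ + b * ⟪y₁, x⟫_ℝ := by
        rw [hw, inner_add_left, real_inner_smul_left, real_inner_smul_left]
      simp only [inner_sub_left, inner_sub_right, inner_add_right, real_inner_smul_left,
        real_inner_smul_right, real_inner_self_eq_norm_sq, hwx]
      rw [hb']
      ring
    have hc1 : ⟪x, a • z₀ + b • z₁⟫_ℝ ≤ ‖x‖ * N := real_inner_le_norm _ _
    have hc2 := neg_abs_le (a * ⟪w - y₀, z₀⟫_ℝ + b * ⟪w - y₁, z₁⟫_ℝ)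
    have hc3 : e * ‖x‖ ^ 2 ≤ e * (‖x‖ * N) + K := by
      have := mul_le_mul_of_nonneg_left hc1 he.le
      rw [hex] at hsum
      linarith
    by_contra! hcon
    have hnx : 0 ≤ ‖x‖ := norm_nonneg _
    have hs : 0 < e * ‖x‖ := hd.trans_le hcon
    have h5 : (e * ‖x‖) ^ 2 ≤ e * (N * (e * ‖x‖) + K) := by
      nlinarith [mul_le_mul_of_nonneg_left hc3 he.le]
    set s := e * ‖x‖
    have h6 : s * (s - e * N) ≤ e * K := by nlinarith
    have h7 : d * (d - e * N) ≤ s * (s - e * N) := by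
      have : 0 ≤ d - e * N := by
        by_contra! hneg
        nlinarith [mul_nonneg he.le hK]
      nlinarith
    nlinarith
  intro p hp q hq a b ha hb hab
  have := map_mem_closure₂ (f := fun p q : X => a • p + b • q) (by fun_prop) hp hq
    (u := displacementClosure T) (by
      rintro _ ⟨z₀, rfl⟩ _ ⟨z₁, rfl⟩
      exact hrange z₀ z₁ a b ha hb hab)
  rwa [IsClosed.closure_eq (by exact isClosed_closure)] at this

/-- For nonexpansive `T`, the vector `v_T` is the unique element of least norm in the closure of
`ran (Id - T)`. -/
theorem minDisplacement_spec {X : Type*} [NormedAddCommGroup X] [InnerProductSpace ℝ X]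
    [CompleteSpace X] {T : X → X} (hT : LipschitzWith 1 T) (v : X) :
    v = minDisplacement T ↔
      v ∈ displacementClosure T ∧ ∀ y ∈ displacementClosure T, ‖v‖ ≤ ‖y‖ := by
  have hu : ∃! p, IsNearestPoint (displacementClosure T) 0 p :=
    existsUnique_isNearestPoint ((Set.range_nonempty fun x => x - T x).mono subset_closure) isClosed_closure
      (convex_displacementClosure hT) 0
  have hv : IsNearestPoint (displacementClosure T) 0 (minDisplacement T) := by
    unfold minDisplacement metricProj
    rw [dif_pos hu.exists]
    exact hu.exists.choose_spec
  have hiff : IsNearestPoint (displacementClosure T) 0 v ↔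
      v ∈ displacementClosure T ∧ ∀ y ∈ displacementClosure T, ‖v‖ ≤ ‖y‖ := by
    simp [IsNearestPoint]
  rw [← hiff]
  exact ⟨fun h => h ▸ hv, fun h => hu.unique h hv⟩

theorem FirmlyNonexpansive.lipschitzWith {X : Type*} [NormedAddCommGroup X]
    [InnerProductSpace ℝ X] {T : X → X} (hT : FirmlyNonexpansive T) : LipschitzWith 1 T := by
  refine LipschitzWith.of_dist_le_mul fun x y => ?_
  rw [dist_eq_norm, dist_eq_norm, NNReal.coe_one, one_mul]
  have h1 := (hT x y).trans (real_inner_le_norm _ _)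
  by_contra! h
  nlinarith [norm_nonneg (x - y)]

theorem lipschitzWith_composition {X : Type*} [NormedAddCommGroup X] :
    ∀ {m : ℕ} {T : Fin m → X → X}, (∀ i, LipschitzWith 1 (T i)) →
      LipschitzWith 1 (composition T)
  | 0, _, _ => LipschitzWith.id
  | m + 1, T, hT => by
    have := (hT (Fin.last m)).comp (lipschitzWith_composition fun i : Fin m => hT i.castSucc)
    simpa [composition] using this

/-! Pick `z i` whose displacement `z i - S i (z i)` is nearly minimal and perturb each map to `G i x
= S i ((1 - δ) • x + (z i - S i (z i)))`. Damping makes every `G i` a strict contraction, so some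
trajectory of the `G i` closes up after `m` steps. Firm nonexpansiveness bounds `δ` times the sum of
its squared norms independently of `δ` (`FirmlyNonexpansive.norm_sq_damped_le`, summed over the
cycle), hence every `δ * ‖x_i‖` tends to zero with `δ`. The unperturbed trajectory from the same
point drifts from the closed one by at most the sum of the perturbations, which is nearly the sum of
the minimal displacements. Translations of the line give sharpness. -/

/-- The `n`-th term of the trajectory `x, G 0 x, G 1 (G 0 x), …`. -/
def trajectory {X : Type*} (G : ℕ → X → X) (x : X) : ℕ → X
  | 0 => x
  | n + 1 => G n (trajectory G x n)

theorem composition_eq_trajectory {X : Type*} (G : ℕ → X → X) (x : X) (m : ℕ) :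
    composition (fun i : Fin m => G i) x = trajectory G x m := by
  induction m with
  | zero => rfl
  | succ m ih => simp only [composition, trajectory, Function.comp_apply, Fin.val_last,
      Fin.val_castSucc, ih]

theorem dist_trajectory_le {X : Type*} [NormedAddCommGroup X] {G : ℕ → X → X} {k : ℝ}
    (hk : 0 ≤ k) (hG : ∀ i x y, ‖G i x - G i y‖ ≤ k * ‖x - y‖) (x y : X) (n : ℕ) :
    ‖trajectory G x n - trajectory G y n‖ ≤ k ^ n * ‖x - y‖ := by
  induction n with
  | zero => simp [trajectory]
  | succ n ih =>
    calc _ ≤ k * ‖trajectory G x n - trajectory G y n‖ := hG _ _ _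
      _ ≤ k * (k ^ n * ‖x - y‖) := by gcongr
      _ = k ^ (n + 1) * ‖x - y‖ := by ring

/-- Contractions composed along a cycle admit a periodic trajectory. -/
theorem exists_trajectory_eq_self {X : Type*} [NormedAddCommGroup X] [CompleteSpace X]
    {G : ℕ → X → X} {k : ℝ} (hk : 0 ≤ k) (hk1 : k < 1)
    (hG : ∀ i x y, ‖G i x - G i y‖ ≤ k * ‖x - y‖) {m : ℕ} (hm : m ≠ 0) :
    ∃ x, trajectory G x m = x := by
  have hc : ContractingWith (⟨k ^ m, pow_nonneg hk m⟩ : NNReal) fun x => trajectory G x m := by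
    refine ⟨?_, LipschitzWith.of_dist_le_mul fun x y => ?_⟩
    · exact_mod_cast pow_lt_one₀ hk hk1 hm
    · rw [dist_eq_norm, dist_eq_norm]
      exact dist_trajectory_le hk hG x y m
  exact ⟨_, hc.fixedPoint_isFixedPt⟩

/-! ### Estimates for the damped, shifted maps -/

theorem FirmlyNonexpansive.norm_sub_le {X : Type*} [NormedAddCommGroup X]
    [InnerProductSpace ℝ X] {T : X → X} (hT : FirmlyNonexpansive T) (x y : X) :
    ‖T x - T y‖ ≤ ‖x - y‖ := by
  simpa using hT.lipschitzWith.norm_sub_le x y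

/-- A step of the regularized iteration grows in norm by no more than a fixed amount. -/
theorem FirmlyNonexpansive.norm_sq_damped_le {X : Type*} [NormedAddCommGroup X]
    [InnerProductSpace ℝ X] {T : X → X} (hT : FirmlyNonexpansive T) {δ : ℝ} (hδ : 0 ≤ δ)
    (hδ' : δ ≤ 1 / 2) (x z : X) :
    (1 + δ) * ‖T ((1 - δ) • x + (z - T z))‖ ^ 2 ≤ ‖x‖ ^ 2 + 4 * ‖T z‖ ^ 2 := by
  have h := hT ((1 - δ) • x + (z - T z)) z
  set u := T ((1 - δ) • x + (z - T z))
  set p := T z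
  -- The shift cancels `z`: the firm inequality against the base point `z` involves only `x`, `u`
  -- and `p`.
  have e : (1 - δ) • x + (z - p) - z = (1 - δ) • x - p := by abel
  rw [e] at h
  -- These squares absorb the cross terms of `h`; the constant 4 is not optimal.
  have h1 : 0 ≤ ‖u - x - (2 : ℝ) • p‖ ^ 2 := sq_nonneg _
  have h2 : 0 ≤ ‖x - p‖ ^ 2 := sq_nonneg _
  have h3 : 0 ≤ ‖u - x‖ ^ 2 := sq_nonneg _
  have h4 : 0 ≤ ‖p‖ ^ 2 := sq_nonneg _
  simp only [← real_inner_self_eq_norm_sq, inner_sub_left, inner_sub_right, real_inner_smul_left,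
    real_inner_smul_right] at h h1 h2 h3 h4 ⊢
  rw [real_inner_comm u x, real_inner_comm u p] at h1
  rw [real_inner_comm x p] at h1 h2
  rw [real_inner_comm u x] at h3
  rw [real_inner_comm u p, real_inner_comm u x] at h
  nlinarith [mul_nonneg hδ h2, mul_nonneg (sub_nonneg.2 hδ') h3, mul_nonneg (sub_nonneg.2 hδ') h4]

/-- Firmly nonexpansive maps applied in turn can nearly return to the starting point, up to the
sum of prescribed displacements. -/
theorem exists_norm_sub_trajectory_le {X : Type*} [NormedAddCommGroup X] [InnerProductSpace ℝ X]
    [CompleteSpace X] {S : ℕ → X → X} (hS : ∀ i, FirmlyNonexpansive (S i)) (z : ℕ → X)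
    {η : ℝ} (hη : 0 < η) {m : ℕ} (hm : m ≠ 0) :
    ∃ x, ‖x - trajectory S x m‖ ≤ ∑ i ∈ Finset.range m, (‖z i - S i (z i)‖ + η) := by
  set P := ∑ i ∈ Finset.range m, ‖S i (z i)‖ ^ 2
  have hP : 0 ≤ P := by positivity
  obtain ⟨δ, hδ, hδ2, hδη⟩ : ∃ δ : ℝ, 0 < δ ∧ δ ≤ 1 / 2 ∧ δ * (4 * P) ≤ η ^ 2 := by
    -- The `+ 1` covers `P = 0`.
    refine ⟨min (1 / 2) (η ^ 2 / (4 * P + 1)), by positivity, min_le_left _ _, ?_⟩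
    calc _ ≤ η ^ 2 / (4 * P + 1) * (4 * P + 1) := by
          gcongr
          · exact min_le_right _ _
          · linarith
      _ = η ^ 2 := by field_simp
  set G : ℕ → X → X := fun i x => S i ((1 - δ) • x + (z i - S i (z i)))
  have hG : ∀ i x y, ‖G i x - G i y‖ ≤ (1 - δ) * ‖x - y‖ := by
    intro i x y
    refine ((hS i).norm_sub_le _ _).trans ?_
    rw [add_sub_add_right_eq_sub, ← smul_sub, norm_smul, Real.norm_of_nonneg (by linarith)]
  obtain ⟨x, hx⟩ := exists_trajectory_eq_self (by linarith) (by linarith) hG hm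
  refine ⟨x, ?_⟩
  have hsum : δ * ∑ i ∈ Finset.range m, ‖trajectory G x i‖ ^ 2 ≤ 4 * P := by
    have hstep := Finset.sum_le_sum fun i (_ : i ∈ Finset.range m) =>
      (hS i).norm_sq_damped_le hδ.le hδ2 (trajectory G x i) (z i)
    -- Since the trajectory closes up, its squared norms over indices `1..m` and `0..m-1` have the
    -- same sum, so only the `δ` term survives in `hstep`.
    have hshift := Finset.sum_range_succ' (fun i => ‖trajectory G x i‖ ^ 2) m
    rw [Finset.sum_range_succ, hx] at hshift
    rw [Finset.sum_add_distrib, ← Finset.mul_sum, ← Finset.mul_sum] at hstep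
    change (1 + δ) * ∑ i ∈ Finset.range m, ‖trajectory G x (i + 1)‖ ^ 2 ≤ _ at hstep
    have h0 : trajectory G x 0 = x := rfl
    rw [h0] at hshift
    have h1 := add_right_cancel hshift
    rw [← h1] at hstep
    linarith
  have hsmall : ∀ i ∈ Finset.range m, δ * ‖trajectory G x i‖ ≤ η := by
    intro i hi
    have h1 := Finset.single_le_sum (f := fun i => ‖trajectory G x i‖ ^ 2)
      (fun _ _ => sq_nonneg _) hi
    refine abs_le_of_sq_le_sq' ?_ hη.le |>.2
    calc (δ * ‖trajectory G x i‖) ^ 2 = δ * (δ * ‖trajectory G x i‖ ^ 2) := by ring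
      _ ≤ δ * (4 * P) := by
        exact mul_le_mul_of_nonneg_left ((mul_le_mul_of_nonneg_left h1 hδ.le).trans hsum) hδ.le
      _ ≤ η ^ 2 := hδη
  -- Nonexpansive maps do not amplify the accumulated error; each step adds only its own
  -- perturbation.
  have herr : ∀ n, ‖trajectory G x n - trajectory S x n‖ ≤
      ∑ i ∈ Finset.range n, (‖z i - S i (z i)‖ + δ * ‖trajectory G x i‖) := by
    intro n
    induction n with
    | zero => simp [trajectory]
    | succ n ih =>
      rw [Finset.sum_range_succ]
      refine ((hS n).norm_sub_le _ _).trans ?_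
      have e : (1 - δ) • trajectory G x n + (z n - S n (z n)) - trajectory S x n =
          (trajectory G x n - trajectory S x n) +
            ((z n - S n (z n)) - δ • trajectory G x n) := by
        rw [sub_smul, one_smul]
        abel
      rw [e]
      refine (norm_add_le _ _).trans (add_le_add ih ((norm_sub_le _ _).trans ?_))
      rw [norm_smul, Real.norm_of_nonneg hδ.le]
  have := herr m
  rw [hx] at this
  refine this.trans (Finset.sum_le_sum fun i hi => ?_)
  linarith [hsmall i hi]

/-! ### Bounds for the composition -/

theorem firmlyNonexpansive_id {X : Type*} [NormedAddCommGroup X] [InnerProductSpace ℝ X] :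
    FirmlyNonexpansive (id : X → X) := fun _ _ => (real_inner_self_eq_norm_sq _).ge

theorem exists_norm_sub_composition_le {X : Type*} [NormedAddCommGroup X]
    [InnerProductSpace ℝ X] [CompleteSpace X] {m : ℕ} (hm : m ≠ 0) {T : Fin m → X → X}
    (hT : ∀ i, FirmlyNonexpansive (T i)) {ε : ℝ} (hε : 0 < ε) :
    ∃ x : X, ‖x - composition T x‖ ≤ ε + ∑ k, ‖minDisplacement (T k)‖ := by
  have hm0 : (0 : ℝ) < m := by exact_mod_cast Nat.pos_of_ne_zero hm
  -- Each of the `m` maps costs `η` twice: once for approximating the minimal displacement by `z`,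
  -- once for the damping.
  set η := ε / (2 * m)
  have hη : 0 < η := by positivity
  have hz : ∀ i, ∃ z, ‖z - T i z‖ ≤ ‖minDisplacement (T i)‖ + η := by
    intro i
    have hv := ((minDisplacement_spec (hT i).lipschitzWith _).1 rfl).1
    obtain ⟨_, ⟨z, rfl⟩, hz⟩ := Metric.mem_closure_iff.1 hv η hη
    refine ⟨z, ?_⟩
    rw [dist_comm, dist_eq_norm] at hz
    have := norm_le_norm_add_norm_sub' (z - T i z) (minDisplacement (T i))
    linarith
  choose z hz using hz
  -- Padding by `id` keeps all maps firmly nonexpansive; indices from `m` on never enter the sum.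
  let S : ℕ → X → X := fun i => if h : i < m then T ⟨i, h⟩ else id
  have hS : ∀ i, FirmlyNonexpansive (S i) := by
    intro i
    by_cases h : i < m
    · simpa only [S, dif_pos h] using hT _
    · simpa only [S, dif_neg h] using firmlyNonexpansive_id
  have hST : (fun i : Fin m => S i) = T := by
    funext i
    simp [S]
  obtain ⟨x, hx⟩ := exists_norm_sub_trajectory_le hS
    (fun i => if h : i < m then z ⟨i, h⟩ else 0) hη hm
  refine ⟨x, ?_⟩
  rw [← composition_eq_trajectory, hST, Finset.sum_range] at hx
  refine hx.trans ?_
  calc _ ≤ ∑ i : Fin m, (‖minDisplacement (T i)‖ + 2 * η) :=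
        Finset.sum_le_sum fun i _ => by
          simp only [S, i.2, dif_pos, Fin.eta]
          linarith [hz i]
    _ = _ := by
        rw [Finset.sum_add_distrib, Finset.sum_const, Finset.card_univ, Fintype.card_fin,
          nsmul_eq_mul]
        simp only [η]
        field_simp
        ring

theorem norm_minDisplacement_composition_le {X : Type*} [NormedAddCommGroup X]
    [InnerProductSpace ℝ X] [CompleteSpace X] {m : ℕ} (hm : m ≠ 0) {T : Fin m → X → X}
    (hT : ∀ i, FirmlyNonexpansive (T i)) :
    ‖minDisplacement (composition T)‖ ≤ ∑ k, ‖minDisplacement (T k)‖ := by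
  refine le_of_forall_pos_le_add fun ε hε => ?_
  obtain ⟨x, hx⟩ := exists_norm_sub_composition_le hm hT hε
  have hv := (minDisplacement_spec (lipschitzWith_composition fun i => (hT i).lipschitzWith) _).1
    rfl
  have := hv.2 _ (subset_closure ⟨x, rfl⟩)
  linarith

/-! ### Translations and sharpness -/

theorem firmlyNonexpansive_of_translation {X : Type*} [NormedAddCommGroup X]
    [InnerProductSpace ℝ X] {T : X → X} {a : X} (hT : ∀ x, T x = x - a) :
    FirmlyNonexpansive T := by
  intro x y
  rw [hT, hT, sub_sub_sub_cancel_right, real_inner_self_eq_norm_sq]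

theorem minDisplacement_of_translation {X : Type*} [NormedAddCommGroup X]
    [InnerProductSpace ℝ X] [CompleteSpace X] {T : X → X} {a : X} (hT : ∀ x, T x = x - a) :
    minDisplacement T = a := by
  -- A translation has constant displacement.
  have hrange : displacementClosure T = {a} := by
    simp [displacementClosure, hT]
  symm
  rw [minDisplacement_spec (firmlyNonexpansive_of_translation hT).lipschitzWith, hrange]
  simp

theorem composition_translation {X : Type*} [AddCommGroup X] {m : ℕ} (c : Fin m → X) (x : X) :
    composition (fun i y => y - c i) x = x - ∑ i, c i := by
  induction m with
  | zero => simp [composition]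
  | succ m ih =>
    simp only [composition, Function.comp_apply, ih fun i => c i.castSucc, Fin.sum_univ_castSucc]
    abel

theorem mainTheorem1 :
    (∀ (X : Type*) [NormedAddCommGroup X] [InnerProductSpace ℝ X] [CompleteSpace X]
      (m : ℕ) (_ : 2 ≤ m) (T : Fin m → X → X) (_ : ∀ i, FirmlyNonexpansive (T i)),
      (∀ ε : ℝ, 0 < ε →
        ∃ x : X, ‖x - composition T x‖ ≤ ε + ∑ k, ‖minDisplacement (T k)‖) ∧
      ‖minDisplacement (composition T)‖ ≤ ∑ k, ‖minDisplacement (T k)‖) ∧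
    (∀ (m : ℕ) (_ : 2 ≤ m) (c : Fin m → ℝ) (_ : ∀ i, 0 ≤ c i),
      ∃ T : Fin m → ℝ → ℝ, (∀ i, FirmlyNonexpansive (T i)) ∧
        (∀ i, ‖minDisplacement (T i)‖ = c i) ∧
        ‖minDisplacement (composition T)‖ = ∑ k, ‖minDisplacement (T k)‖) ∧
    (∀ (a₁ a₂ : ℝ) (T₁ T₂ : ℝ → ℝ) (_ : ∀ x, T₁ x = x - a₁) (_ : ∀ x, T₂ x = x - a₂),
      FirmlyNonexpansive T₁ ∧ FirmlyNonexpansive T₂ ∧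
      minDisplacement T₁ = a₁ ∧ minDisplacement T₂ = a₂ ∧
      minDisplacement (T₂ ∘ T₁) = a₁ + a₂ ∧
      (|minDisplacement (T₂ ∘ T₁)| = |minDisplacement T₁| + |minDisplacement T₂| ↔
        0 ≤ a₁ * a₂)) := by

  refine ⟨fun X _ _ _ m hm T hT => ⟨fun ε hε => ?_, ?_⟩, fun m hm c hc => ?_,
    fun a₁ a₂ T₁ T₂ h₁ h₂ => ?_⟩
  · exact exists_norm_sub_composition_le (by omega) hT hε
  · exact norm_minDisplacement_composition_le (by omega) hT
  · have hT : ∀ i, minDisplacement (fun x : ℝ => x - c i) = c i := fun i =>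
      minDisplacement_of_translation fun _ => rfl
    refine ⟨fun i x => x - c i, fun i => firmlyNonexpansive_of_translation fun _ => rfl,
      fun i => ?_, ?_⟩
    · rw [hT, Real.norm_of_nonneg (hc i)]
    · rw [minDisplacement_of_translation (composition_translation c),
        Real.norm_of_nonneg (Finset.sum_nonneg fun i _ => hc i)]
      exact Finset.sum_congr rfl fun i _ => by rw [hT, Real.norm_of_nonneg (hc i)]
  · have h₁₂ : minDisplacement (T₂ ∘ T₁) = a₁ + a₂ :=
      minDisplacement_of_translation fun x => by rw [Function.comp_apply, h₁, h₂, sub_sub]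
    refine ⟨firmlyNonexpansive_of_translation h₁, firmlyNonexpansive_of_translation h₂,
      minDisplacement_of_translation h₁, minDisplacement_of_translation h₂, h₁₂, ?_⟩
    rw [h₁₂, minDisplacement_of_translation h₁, minDisplacement_of_translation h₂,
      abs_add_eq_add_abs_iff, mul_nonneg_iff]
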